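/- \textbf{Setting.} There are $n\ge 3$ participants and $m\ge 1$ candidates, and $s\ge 0$ is the security parameter. A set $H$ of participants is honest; the other participants are corrupt and are controlled by one static, active, computationally unbounded, randomized adversary. The numbers of honest and of corrupt participants are arbitrary. Each participant $i$ has an input $x_i\in\{1,\dots,m\}$. Every two participants share a private authentic channel, and there is a simultaneous broadcast channel. For $v\in\mathbb Z$ let $$p_v=\frac12\Big(\frac{n-2}{n}\Big)^v\Big(\Big(\frac{n}{n-2}\Big)^v-1\Big).$$ \textbf{The vote protocol.} \emph{Phase A.} For each candidate $k=1,\dots,m$ and each $j=1,\dots,s$, every participant $i$ sets $p_i=0$ if $x_i\ne k$; if $x_i=k$, he sets $p_i=1$ with probability $1/n$ and $p_i=0$ otherwise. He then picks a uniformly random string $r_i\in\{0,1\}^n$ whose Hamming weight has parity $p_i$, sends the bit $r_i^l$ to participant $l$ for every $l\neq i$ and keeps $r_i^i$. He stores as $z[k]_i^j$ the parity of the bits that he received, including $r_i^i$. \emph{Phase B.} All participants simultaneously broadcast all their bits $z[k]_i^j$. The protocol aborts if a bit is missing; an honest participant who did not get all his bits in Phase A cannot broadcast. \emph{Phase C.}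 Each participant $i$ computes $p[k]_j=\bigoplus_{l=1}^n z[k]_l^j$ and $\sigma[k]_i=\frac1s\sum_{j=1}^s p[k]_j$. For each $k$, if there is an integer $v$ with $|\sigma[k]_i-p_v|<\frac1{2e^2n}$, he sets $y[k]_i$ to such a $v$ (if there are several, he uses an arbitrary deterministic rule of his own). He aborts if for some $k$ there is no such $v$, or if $\sum_{k=1}^m y[k]_i\ne n$. Otherwise his output is $(y[1]_i,\dots,y[m]_i)$. Corrupt participants may deviate arbitrarily. They may withhold bits, and all their messages and broadcast bits may depend on the adversary's randomness and on all the bits that honest participants send to corrupt ones, but not on the bits that the honest participants broadcast simultaneously. \textbf{Lemma (Correctness).} There is an absolute constant $c>0$ such that for all $n\ge3$, $m\ge1$ and $s$, every set of honest participants, all their inputs, every adversary and all choice rules, the following holds with probability at least $1-m\,e^{-cs/n^2}$: there are inputs $x_i\in\{1,\dots,m\}$ for the corrupt participants $i$ such that every honest participant who does not abort outputs the tallies of the ideal functionality, $y[k]=|\{i : x_i=k\}|$ for $k=1,\dots,m$, where $i$ ranges over all participants. In particular, if the protocol does not abort, then, except with probability exponentially small in $s$, the output of all honest participants equals the output of the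 ideal functionality for some inputs of the corrupt participants. -/

import Mathlib

open scoped NNReal ENNReal

noncomputable section

namespace Vote

/-- Bits, with exclusive or as addition. -/
abbrev Bit := ZMod 2

/-- The joint law of independent variables with laws `p i`. -/
def independent {ι : Type} [Fintype ι] [DecidableEq ι] {α : Type} [Fintype α]
    (p : ι → PMF α) : PMF (ι → α) :=
  PMF.ofFintype (fun f => ∏ i, p i (f i)) (by
    have h : ∀ i, ∑ a, p i a = 1 := fun i => by
      rw [← tsum_fintype (L := .unconditional _)]
      exact (p i).tsum_coe
    rw [← Fintype.piFinset_univ, ← Finset.prod_univ_sum]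
    simp [h])

/-! ### Honest behaviour in Phase A -/

/-- The law of the bit `p_i` of an honest participant in one repetition for one candidate:
if he votes for the candidate, `1` with probability `1 / n` and `0` otherwise;
if he does not, always `0`. -/
def flipLaw (n : ℕ) (votesForIt : Prop) [Decidable votesForIt] : PMF Bit :=
  if votesForIt then
    PMF.ofFintype (fun b : Bit => if b = 1 then (((n : ℝ≥0)⁻¹ : ℝ≥0) : ℝ≥0∞)
        else ((1 - (n : ℝ≥0)⁻¹ : ℝ≥0) : ℝ≥0∞)) (by
      have h : (n : ℝ≥0)⁻¹ ≤ 1 := Nat.cast_inv_le_one n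
      have h2 : (Finset.univ : Finset Bit) = {0, 1} := rfl
      rw [h2, Finset.sum_pair (by decide), if_neg (by decide), if_pos rfl, ← ENNReal.coe_add,
        tsub_add_cancel_of_le h, ENNReal.coe_one])
  else PMF.pure 0

/-- A uniformly random `n`-bit string whose Hamming weight has parity `p`, as chosen by
participant `i` in the parity protocol with input `p`. -/
def shareLaw {n : ℕ} (i : Fin n) (p : Bit) : PMF (Fin n → Bit) :=
  PMF.uniformOfFinset {r : Fin n → Bit | ∑ j, r j = p} ⟨Pi.single i p, by simp⟩

/-- The strings chosen by the participants of the set `H` of honest participants: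
`R i k j l` is the bit that the honest participant `i` sends to participant `l` (and keeps if
`l = i`) in the `j`-th repetition for candidate `k`. -/
abbrev HonestShares {n : ℕ} (H : Finset (Fin n)) (m s : ℕ) : Type :=
  H → Fin m → Fin s → Fin n → Bit

/-- The law of the honest strings, when the honest participants have inputs `x`. -/
def honestLaw {n m : ℕ} {H : Finset (Fin n)} (s : ℕ) (x : H → Fin m) :
    PMF (HonestShares H m s) :=
  independent fun i => independent fun k => independent fun _ =>
    (flipLaw n (x i = k)).bind (shareLaw (i : Fin n))

/-! ### The adversary -/

/-- What the adversary receives: the bits sent by honest to corrupt participants. -/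
abbrev View {n : ℕ} (H : Finset (Fin n)) (m s : ℕ) : Type :=
  H → {l : Fin n // l ∉ H} → Fin m → Fin s → Bit

/-- The adversary's view of the honest strings. -/
def view {n m s : ℕ} {H : Finset (Fin n)} (R : HonestShares H m s) : View H m s :=
  fun i l k j => R i k j l

/-- Everything that the corrupt participants do; `none` means that a bit is withheld. -/
structure CorruptActions {n : ℕ} (H : Finset (Fin n)) (m s : ℕ) where
  /-- Phase A: `sent l i k j` goes from the corrupt participant `l` to the honest one `i`. -/
  sent : {l : Fin n // l ∉ H} → H → Fin m → Fin s → Option Bit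
  /-- Phase B: `announced l k j` is the contribution of `l` to the simultaneous broadcast. -/
  announced : {l : Fin n // l ∉ H} → Fin m → Fin s → Option Bit

/-- An active, computationally unbounded, randomized adversary that controls the participants
outside `H`. Its actions may depend arbitrarily on its whole view (so in particular on the
part that has arrived when it acts). As the broadcast of Phase B is simultaneous, they do not
depend on the bits that the honest participants broadcast. -/
abbrev Adversary {n : ℕ} (H : Finset (Fin n)) (m s : ℕ) : Type :=
  View H m s → PMF (CorruptActions H m s)

/-! ### Phases A and B -/

/-- The parity of the given bits, if none of them is missing. -/
def parity? {n : ℕ} (b : Fin n → Option Bit) : Option Bit :=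
  if ∀ l, (b l).isSome then some (∑ l, (b l).getD 0) else none

/-- The bit received by the honest participant `i` from participant `l`. -/
def received {n m s : ℕ} {H : Finset (Fin n)} (R : HonestShares H m s)
    (a : CorruptActions H m s) (i : H) (k : Fin m) (j : Fin s) (l : Fin n) : Option Bit :=
  if h : l ∈ H then some (R ⟨l, h⟩ k j i) else a.sent ⟨l, h⟩ i k j

/-- The contributions to the simultaneous broadcast: `b i k j` is announced by participant `i`
for the `j`-th repetition for candidate `k`; `none` if there is no such announcement. -/
abbrev Broadcast (n m s : ℕ) : Type := Fin n → Fin m → Fin s → Option Bit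

/-- An honest participant announces the parity of the bits received, provided that they
all arrived; a corrupt one whatever the adversary decides. -/
def broadcast {n m s : ℕ} {H : Finset (Fin n)} (R : HonestShares H m s)
    (a : CorruptActions H m s) : Broadcast n m s :=
  fun i k j => if h : i ∈ H then parity? (received R a ⟨i, h⟩ k j) else a.announced ⟨i, h⟩ k j

/-- The law of the broadcast in an execution of the protocol in which the honest participants
have inputs `x`. -/
def voteLaw {n m s : ℕ} {H : Finset (Fin n)} (x : H → Fin m) (adv : Adversary H m s) :
    PMF (Broadcast n m s) :=
  (honestLaw s x).bind fun R => (adv (view R)).map fun a => broadcast R a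

/-! ### Phase C -/

/-- The number `p_v`. -/
def pValue (n : ℕ) (v : ℤ) : ℝ :=
  1 / 2 * (((n : ℝ) - 2) / n) ^ v * (((n : ℝ) / (n - 2)) ^ v - 1)

/-- The condition on the integer `v` for being the tally of a candidate with frequency `σ`. -/
def Fits (n : ℕ) (σ : ℝ) (v : ℤ) : Prop :=
  |σ - pValue n v| < 1 / (2 * Real.exp 1 ^ 2 * n)

/-- A way to choose, given the frequency `σ`, an integer `v` that fits, if there is one. -/
structure IsTallyRule (n : ℕ) (rule : ℝ → Option ℤ) : Prop where
  fits : ∀ σ v, rule σ = some v → Fits n σ v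
  isSome : ∀ σ, (∃ v, Fits n σ v) → (rule σ).isSome

/-- The frequency `σ[k]` of odd parities among the `s` repetitions for candidate `k`. -/
def frequency {n m s : ℕ} (b : Broadcast n m s) (k : Fin m) : ℝ :=
  (∑ j : Fin s, if parity? (fun i => b i k j) = some 1 then (1 : ℝ) else 0) / s

open Classical in
/-- The tallies computed by a participant from the broadcast, or `none` if he aborts: because
the broadcast is incomplete, because there is no tally for some candidate, or because the
tallies do not sum to `n`. -/
def output {n m s : ℕ} (rule : ℝ → Option ℤ) (b : Broadcast n m s) : Option (Fin m → ℤ) :=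
  if (∀ i k j, (b i k j).isSome) ∧ (∀ k, (rule (frequency b k)).isSome) ∧
      ∑ k, (rule (frequency b k)).getD 0 = n then
    some fun k => (rule (frequency b k)).getD 0
  else none

/-! ### The ideal functionality -/

/-- The inputs of all participants, from those of the honest and of the corrupt ones. -/
def allInputs {n m : ℕ} {H : Finset (Fin n)} (x : H → Fin m) (w : {l : Fin n // l ∉ H} → Fin m) :
    Fin n → Fin m :=
  fun i => if h : i ∈ H then x ⟨i, h⟩ else w ⟨i, h⟩

/-- The number of participants whose input is `k`, for each candidate `k`. -/
def idealTally {n m : ℕ} (X : Fin n → Fin m) (k : Fin m) : ℤ :=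
  (Finset.univ.filter fun i => X i = k).card

/-- There are inputs of the corrupt participants for which every honest participant that does
not abort outputs the tallies of the ideal functionality. -/
def Correct {n m s : ℕ} {H : Finset (Fin n)} (x : H → Fin m) (rule : H → ℝ → Option ℤ)
    (b : Broadcast n m s) : Prop :=
  ∃ w : {l : Fin n // l ∉ H} → Fin m, ∀ (i : H) (y : Fin m → ℤ),
    output (rule i) b = some y → y = idealTally (allInputs x w)

end Vote

end

/-! A uniform string of parity `p` is a uniform even string with `p` added at the position that its
author keeps. Corrupt participants never see that position, so the adversary's view depends on the
even strings alone, and the secret bits can be drawn after the adversary has acted (`voteLaw_eq`).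
In a complete broadcast, each parity is then the sum of the honest secret bits plus a bit fixed
beforehand (`parity?_broadcast`).

If `h` honest participants vote for a candidate, the sum of their bits is 1 with probability `p_h ≤
1/2`. A fixed shift leaves this probability or replaces it by `1 - p_h ≥ p_h`. Hence cheating cannot
noticeably push a frequency below `p_h`; a Chernoff bound and a union bound over candidates make
this precise.

On the good event every fitting tally is at least the honest one, since `p_h - p_(h-1)` exceeds the
tolerance. As the tallies sum to `n`, the surplus over the honest votes can be assigned to the
corrupt participants. Different choice rules still agree: ambiguity requires a value of at least
`n`, which the sum condition excludes (`eq_of_fits`). -/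

namespace Vote

/-! ### Product laws -/

section Independent

variable {ι κ : Type} [Fintype ι] [DecidableEq ι] [Fintype κ] [DecidableEq κ]
  {α β : Type} [Fintype α] [Fintype β]

theorem independent_apply (p : ι → PMF α) (f : ι → α) :
    independent p f = ∏ i, p i (f i) := rfl

theorem independent_bind (p : ι → PMF α) (f : ι → α → PMF β) :
    independent (fun i => (p i).bind (f i)) =
      (independent p).bind fun a => independent fun i => f i (a i) := by
  classical
  ext b
  simp only [independent_apply, PMF.bind_apply, tsum_fintype, ← Finset.prod_mul_distrib]
  rw [Finset.prod_univ_sum, Fintype.piFinset_univ]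

theorem independent_pure (a : ι → α) :
    independent (fun i => PMF.pure (a i)) = PMF.pure a := by
  classical
  ext b
  simp only [independent_apply, PMF.pure_apply]
  by_cases h : b = a
  · simp [h]
  · rw [if_neg h]
    obtain ⟨i, hi⟩ := Function.ne_iff.mp h
    exact Finset.prod_eq_zero (Finset.mem_univ i) (if_neg hi)

theorem independent_map (p : ι → PMF α) (g : ι → α → β) :
    independent (fun i => (p i).map (g i)) =
      (independent p).map fun a i => g i (a i) := by
  have h := independent_bind p fun i => PMF.pure ∘ g i
  simp only [Function.comp_apply, independent_pure] at h
  exact h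

theorem independent_bind_map {γ : Type} [Fintype γ] (p : ι → PMF α) (q : ι → PMF β)
    (g : ι → α → β → γ) :
    independent (fun i => (p i).bind fun a => (q i).map (g i a)) =
      (independent p).bind fun a => (independent q).map fun u i => g i (a i) (u i) := by
  rw [independent_bind]
  congr 1
  funext a
  exact independent_map q fun i => g i (a i)

theorem independent_map_eval (p : ι → PMF α) (i : ι) :
    (independent p).map (fun f => f i) = p i := by
  classical
  ext a
  rw [PMF.map_apply, tsum_fintype, ← Finset.sum_filter]
  have hs : (Finset.univ.filter fun f : ι → α => a = f i) =
      Fintype.piFinset fun i' => if i' = i then {a} else Finset.univ := by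
    ext f
    simp only [Finset.mem_filter, Finset.mem_univ, true_and, Fintype.mem_piFinset]
    refine ⟨fun h i' => ?_, fun h => ?_⟩
    · split_ifs with hi
      · subst hi; simp [h]
      · simp
    · simpa [eq_comm] using h i
  rw [hs]
  simp only [independent_apply]
  rw [← Finset.prod_univ_sum, Finset.prod_eq_single i]
  · simp
  · intro j _ hj
    rw [if_neg hj, ← tsum_fintype (L := .unconditional _), (p j).tsum_coe]
  · simp

theorem independent_swap (p : ι → κ → PMF α) :
    (independent fun i => independent (p i)).map Function.swap =
      independent fun j => independent fun i => p i j := by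
  classical
  ext f
  rw [PMF.map_apply, tsum_eq_single (Function.swap f)]
  · simp only [independent_apply]
    rw [if_pos trivial, Finset.prod_comm]
  · rintro g hg
    exact if_neg fun h => hg (by rw [h])

/-- Conditioning: used to freeze the even strings and the adversary's actions. -/
theorem toOuterMeasure_bind_le {α β : Type} {p : PMF α} {f : α → PMF β} {S : Set β} {c : ℝ≥0∞}
    (h : ∀ a, (f a).toOuterMeasure S ≤ c) : (p.bind f).toOuterMeasure S ≤ c := by
  rw [PMF.toOuterMeasure_bind_apply]
  calc ∑' a, p a * (f a).toOuterMeasure S ≤ ∑' a, p a * c :=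
        ENNReal.tsum_le_tsum fun a => by gcongr; exact h a
    _ = c := by rw [ENNReal.tsum_mul_right, p.tsum_coe, one_mul]

/-- The exponential Markov inequality for independent variables. -/
theorem independent_toOuterMeasure_le (p : ι → PMF α) (φ : ι → α → ℝ≥0∞) (C B : ℝ≥0∞)
    (S : Set (ι → α)) (hS : ∀ f ∈ S, 1 ≤ C * ∏ i, φ i (f i))
    (hB : ∀ i, ∑ a, p i a * φ i a ≤ B) :
    (independent p).toOuterMeasure S ≤ C * B ^ Fintype.card ι := by
  classical
  rw [PMF.toOuterMeasure_apply_fintype]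
  calc ∑ f, S.indicator (independent p) f
      ≤ ∑ f : ι → α, C * ∏ i, p i (f i) * φ i (f i) := by
        refine Finset.sum_le_sum fun f _ => ?_
        by_cases hf : f ∈ S
        · rw [Set.indicator_of_mem hf, Finset.prod_mul_distrib, mul_left_comm]
          exact le_mul_of_one_le_right (zero_le) (hS f hf)
        · rw [Set.indicator_of_notMem hf]; exact zero_le
    _ = C * ∏ i, ∑ a, p i a * φ i a := by
        rw [← Finset.mul_sum, Finset.prod_univ_sum, Fintype.piFinset_univ]
    _ ≤ C * B ^ Fintype.card ι := by
        gcongr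
        exact (Finset.prod_le_prod' fun i _ => hB i).trans_eq (by simp)

end Independent

/-! ### The honest strings -/

theorem shareLaw_apply {n : ℕ} (i : Fin n) (p : Bit) (r : Fin n → Bit) :
    shareLaw i p r = if ∑ j, r j = p then
      ((Finset.univ.filter fun r : Fin n → Bit => ∑ j, r j = p).card : ℝ≥0∞)⁻¹ else 0 :=
  (PMF.uniformOfFinset_apply _ _).trans (by simp)

/-- Translation by `Pi.single i p` is a bijection from even strings to strings of parity `p`, so it
carries one uniform law to the other. -/
theorem shareLaw_eq_map {n : ℕ} (i : Fin n) (p : Bit) :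
    shareLaw i p = (shareLaw i 0).map fun u => u + Pi.single i p := by
  classical
  ext r
  rw [PMF.map_apply, tsum_eq_single (r - Pi.single i p)]
  · rw [if_pos (by simp), shareLaw_apply, shareLaw_apply]
    have hc : (Finset.univ.filter fun r : Fin n → Bit => ∑ j, r j = p).card =
        (Finset.univ.filter fun r : Fin n → Bit => ∑ j, r j = 0).card :=
      Finset.card_equiv (Equiv.subRight (Pi.single i p)) fun r => by
        simp [Finset.sum_sub_distrib, sub_eq_zero]
    rw [hc]
    simp [Finset.sum_sub_distrib, sub_eq_zero]
  · intro u hu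
    exact if_neg fun h => hu (by rw [h]; simp)

/-- The law of the secret bits of the honest participants. -/
noncomputable def bitsLaw {n m : ℕ} {H : Finset (Fin n)} (s : ℕ) (x : H → Fin m) :
    PMF (H → Fin m → Fin s → Bit) :=
  independent fun i => independent fun k => independent fun _ => flipLaw n (x i = k)

/-- The law of strings of even weight. -/
noncomputable def maskLaw {n : ℕ} (H : Finset (Fin n)) (m s : ℕ) : PMF (HonestShares H m s) :=
  independent fun i => independent fun _ => independent fun _ => shareLaw (i : Fin n) 0

/-- The strings obtained from strings of even weight by adding the secret bits in the positions
that the participants keep. -/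
def addBits {n m s : ℕ} {H : Finset (Fin n)} (P : H → Fin m → Fin s → Bit)
    (U : HonestShares H m s) : HonestShares H m s :=
  fun i k j => U i k j + Pi.single (i : Fin n) (P i k j)

theorem honestLaw_eq {n m : ℕ} {H : Finset (Fin n)} (s : ℕ) (x : H → Fin m) :
    honestLaw s x = (bitsLaw s x).bind fun P => (maskLaw H m s).map (addBits P) := by
  unfold honestLaw bitsLaw maskLaw addBits
  have h : ∀ (i : H) (k : Fin m), (flipLaw n (x i = k)).bind (shareLaw (i : Fin n)) =
      (flipLaw n (x i = k)).bind fun p => (shareLaw (i : Fin n) 0).map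
        fun u => u + Pi.single (i : Fin n) p := fun i k => by
    congr 1; funext p; exact shareLaw_eq_map _ p
  simp only [h, independent_bind_map]

theorem view_addBits {n m s : ℕ} {H : Finset (Fin n)} (P : H → Fin m → Fin s → Bit)
    (U : HonestShares H m s) : view (addBits P U) = view U := by
  funext i l k j
  have h : (l : Fin n) ≠ i := fun h => l.2 (h ▸ i.2)
  simp [view, addBits, h]

/-- This is the privacy step: by `view_addBits` the adversary acts on `view U` only, so the draw of
the secret bits commutes past its actions. -/
theorem voteLaw_eq {n m s : ℕ} {H : Finset (Fin n)} (x : H → Fin m) (adv : Adversary H m s) :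
    voteLaw x adv = (maskLaw H m s).bind fun U => (adv (view U)).bind fun a =>
      (bitsLaw s x).map fun P => broadcast (addBits P U) a := by
  rw [voteLaw, honestLaw_eq, PMF.bind_bind]
  simp only [PMF.bind_map, Function.comp_def, view_addBits]
  rw [PMF.bind_comm]
  congr 1
  funext U
  simp only [PMF.map, Function.comp_def]
  rw [PMF.bind_comm]

/-! ### The parities -/

theorem parity?_eq {n : ℕ} {b : Fin n → Option Bit} (h : ∀ l, (b l).isSome) :
    parity? b = some (∑ l, (b l).getD 0) := if_pos h

theorem isSome_of_isSome_parity? {n : ℕ} {b : Fin n → Option Bit} (h : (parity? b).isSome) :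
    ∀ l, (b l).isSome := by
  unfold parity? at h
  split_ifs at h with hb
  · exact hb
  · simp at h

/-- The bit `P i k j` sits only in the position kept by `i`, so it enters the total exactly once,
through the announcement of `i`. Everything else is determined by `U` and `a`. -/
theorem parity?_broadcast {n m s : ℕ} {H : Finset (Fin n)} (P : H → Fin m → Fin s → Bit)
    (U : HonestShares H m s) (a : CorruptActions H m s)
    (hc : ∀ i k j, (broadcast (addBits P U) a i k j).isSome) (k : Fin m) (j : Fin s) :
    parity? (fun i => broadcast (addBits P U) a i k j) =
      some (∑ i, P i k j +
        ∑ i, if h : i ∈ H then ∑ l, (received U a ⟨i, h⟩ k j l).getD 0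
          else (a.announced ⟨i, h⟩ k j).getD 0) := by
  classical
  rw [parity?_eq fun i => hc i k j]
  congr 1
  have hP : ∑ i, P i k j = ∑ i : Fin n, if h : i ∈ H then P ⟨i, h⟩ k j else 0 := by
    rw [← Finset.sum_subset (Finset.subset_univ H) fun i _ hi => dif_neg hi]
    refine Eq.trans ?_ (Finset.sum_coe_sort H _)
    exact Fintype.sum_congr _ _ fun i => by rw [dif_pos i.2]
  rw [hP, ← Finset.sum_add_distrib]
  refine Finset.sum_congr rfl fun i _ => ?_
  by_cases h : i ∈ H
  · have hi := hc i k j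
    simp only [broadcast, dif_pos h] at hi ⊢
    rw [parity?_eq (isSome_of_isSome_parity? hi), Option.getD_some]
    have hr : ∀ l, (received (addBits P U) a ⟨i, h⟩ k j l).getD 0 =
        (if l = i then P ⟨i, h⟩ k j else 0) + (received U a ⟨i, h⟩ k j l).getD 0 := by
      intro l
      by_cases hl : l ∈ H
      · by_cases hli : l = i
        · subst hli
          simp [received, hl, addBits, add_comm]
        · simp [received, hl, addBits, hli, Ne.symm hli]
      · have hli : l ≠ i := fun e => hl (e ▸ h)
        simp [received, hl, hli]
    simp only [hr, Finset.sum_add_distrib]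
    simp
  · simp [broadcast, h]

/-! ### The law of the sum of the secret bits -/

/-- The law of the sum of the secret bits of the honest participants in one repetition for the
candidate `k`. -/
noncomputable def sumLaw {n m : ℕ} {H : Finset (Fin n)} (x : H → Fin m) (k : Fin m) : PMF Bit :=
  (independent fun i => flipLaw n (x i = k)).map fun f => ∑ i, f i

theorem bitsLaw_map_sum {n m : ℕ} {H : Finset (Fin n)} (s : ℕ) (x : H → Fin m) (k : Fin m) :
    (bitsLaw s x).map (fun P j => ∑ i, P i k j) = independent fun _ : Fin s => sumLaw x k := by
  unfold sumLaw
  rw [independent_map (fun _ : Fin s => independent fun i : H => flipLaw n (x i = k))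
    (fun _ f => ∑ i, f i), ← independent_swap (fun (i : H) (_ : Fin s) => flipLaw n (x i = k)),
    PMF.map_comp]
  have h : (fun i : H => independent fun _ : Fin s => flipLaw n (x i = k)) = fun i : H =>
      (independent fun k => independent fun _ : Fin s => flipLaw n (x i = k)).map
        fun f => f k := by
    funext i
    rw [independent_map_eval (fun k => independent fun _ : Fin s => flipLaw n (x i = k)) k]
  rw [h, independent_map, PMF.map_comp]
  rfl

/-- The nontrivial character of `Bit`. -/
def sign (b : Bit) : ℝ := if b = 0 then 1 else -1

theorem sign_add (a b : Bit) : sign (a + b) = sign a * sign b := by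
  revert a b
  have h : ∀ a b : Bit, a + b = 0 ↔ (a = 0 ↔ b = 0) := by decide
  intro a b
  unfold sign
  by_cases ha : a = 0 <;> by_cases hb : b = 0 <;> simp [h, ha, hb]

theorem sign_sum {ι : Type} (S : Finset ι) (f : ι → Bit) :
    sign (∑ i ∈ S, f i) = ∏ i ∈ S, sign (f i) := by
  classical
  induction S using Finset.induction_on with
  | empty => simp [sign]
  | insert a S ha ih => rw [Finset.sum_insert ha, Finset.prod_insert ha, sign_add, ih]

theorem sum_bit {M : Type} [AddCommMonoid M] (f : Bit → M) : ∑ b, f b = f 0 + f 1 :=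
  Fin.sum_univ_two f

theorem toReal_zero_add_toReal_one (p : PMF Bit) : (p 0).toReal + (p 1).toReal = 1 := by
  rw [← ENNReal.toReal_add (p.apply_ne_top _) (p.apply_ne_top _), ← sum_bit,
    ← tsum_fintype (L := .unconditional _), p.tsum_coe, ENNReal.toReal_one]

theorem flipLaw_sign {n : ℕ} (hn : 3 ≤ n) (q : Prop) [Decidable q] :
    ∑ b, (flipLaw n q b).toReal * sign b = if q then ((n : ℝ) - 2) / n else 1 := by
  have hn' : (n : ℝ) ≠ 0 := by positivity
  rw [sum_bit]
  have h := toReal_zero_add_toReal_one (flipLaw n q)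
  have h1 : (flipLaw n q 1).toReal = if q then (n : ℝ)⁻¹ else 0 := by
    unfold flipLaw
    split_ifs
    · rw [PMF.ofFintype_apply]; simp
    · simp
  have e0 : sign 0 = 1 := if_pos rfl
  have e1 : sign 1 = -1 := if_neg (by decide)
  rw [e0, e1, eq_sub_of_add_eq h, h1]
  split_ifs
  · field_simp; ring
  · norm_num

/-- The expected sign is multiplicative over independent bits: each honest vote for `k` contributes
`1 - 2/n`, every other participant 1. -/
theorem sumLaw_sign {n m : ℕ} (hn : 3 ≤ n) {H : Finset (Fin n)} (x : H → Fin m) (k : Fin m) :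
    ∑ b, (sumLaw x k b).toReal * sign b =
      (((n : ℝ) - 2) / n) ^ (Finset.univ.filter fun i => x i = k).card := by
  classical
  have h1 : ∀ b, (sumLaw x k b).toReal = ∑ f : H → Bit,
      if b = ∑ i, f i then ∏ i, (flipLaw n (x i = k) (f i)).toReal else 0 := by
    intro b
    rw [sumLaw, PMF.map_apply, tsum_fintype, ENNReal.toReal_sum]
    · refine Finset.sum_congr rfl fun f _ => ?_
      split_ifs
      · rw [independent_apply, ENNReal.toReal_prod]
      · rfl
    · intro f _
      split_ifs
      · exact PMF.apply_ne_top _ _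
      · simp
  simp only [h1, Finset.sum_mul]
  rw [Finset.sum_comm]
  simp only [ite_mul, zero_mul, Finset.sum_ite_eq', Finset.mem_univ, if_true,
    sign_sum, ← Finset.prod_mul_distrib]
  rw [← Fintype.piFinset_univ, ← Finset.prod_univ_sum (fun _ => Finset.univ)
    (fun i b => (flipLaw n (x i = k) b).toReal * sign b)]
  simp only [flipLaw_sign hn]
  rw [Finset.prod_ite, Finset.prod_const, Finset.prod_const_one, mul_one]

/-! ### The numbers `p_v` -/

theorem base_pos {n : ℕ} (hn : 3 ≤ n) : 0 < ((n : ℝ) - 2) / n := by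
  have : (3 : ℝ) ≤ n := by exact_mod_cast hn
  apply div_pos <;> linarith

theorem base_le_one {n : ℕ} (hn : 3 ≤ n) : ((n : ℝ) - 2) / n ≤ 1 := by
  have : (3 : ℝ) ≤ n := by exact_mod_cast hn
  rw [div_le_one] <;> linarith

theorem pValue_eq {n : ℕ} (hn : 3 ≤ n) (v : ℤ) :
    pValue n v = (1 - (((n : ℝ) - 2) / n) ^ v) / 2 := by
  have h := (zpow_pos (base_pos hn) v).ne'
  rw [pValue, ← inv_div ((n : ℝ) - 2) n, inv_zpow]
  field_simp

theorem pValue_le_half {n : ℕ} (hn : 3 ≤ n) (v : ℤ) : pValue n v ≤ 1 / 2 := by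
  rw [pValue_eq hn]
  linarith [zpow_pos (base_pos hn) v]

theorem pValue_nonneg {n : ℕ} (hn : 3 ≤ n) (v : ℕ) : 0 ≤ pValue n v := by
  rw [pValue_eq hn, zpow_natCast]
  linarith [pow_le_one₀ (n := v) (base_pos hn).le (base_le_one hn)]

/-- With `q = (n-2)/n`, consecutive values differ by `p_w - p_(w-1) = q^(w-1)/n`, and `p` is
increasing. -/
theorem pValue_gap {n : ℕ} (hn : 3 ≤ n) {v w : ℤ} {M : ℕ} (hvw : v < w) (hw : w ≤ M + 1) :
    (((n : ℝ) - 2) / n) ^ M / n ≤ pValue n w - pValue n v := by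
  have hn' : (n : ℝ) ≠ 0 := by positivity
  have h1 := zpow_le_zpow_right_of_le_one₀ (base_pos hn) (base_le_one hn)
    (show v ≤ w - 1 by omega)
  have h2 := zpow_le_zpow_right_of_le_one₀ (base_pos hn) (base_le_one hn)
    (show w - 1 ≤ M by omega)
  have h3 := zpow_add_one₀ (base_pos hn).ne' (w - 1)
  rw [sub_add_cancel] at h3
  rw [zpow_natCast] at h2
  rw [pValue_eq hn, pValue_eq hn, h3]
  have h4 : ((n : ℝ) - 2) / n = 1 - 2 / n := by field_simp
  have h5 := div_le_div_of_nonneg_right h2 (show (0 : ℝ) ≤ n by positivity)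
  generalize (((n : ℝ) - 2) / n) ^ (w - 1) = A at *
  have h6 : A * (1 - 2 / n) = A - 2 * (A / n) := by ring
  rw [h4] at *
  rw [h6]
  linarith

/-- For `N = n - 2` the base is `1/(1 + 2/N) ≥ exp(-2/N)`; take the `N`-th power. -/
theorem exp_neg_two_le_base_pow {n : ℕ} (hn : 3 ≤ n) :
    Real.exp (-2) ≤ (((n : ℝ) - 2) / n) ^ (n - 2) := by
  obtain ⟨N, rfl⟩ := Nat.exists_eq_add_of_le' (show 2 ≤ n by omega)
  have hN : (0 : ℝ) < N := by exact_mod_cast (show 0 < N by omega)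
  have h1 : Real.exp (-(2 / N)) ≤ ((N + 2 : ℕ) - 2 : ℝ) / (N + 2 : ℕ) := by
    rw [Real.exp_neg]
    refine (inv_anti₀ (by positivity) (Real.add_one_le_exp (2 / (N : ℝ)))).trans_eq ?_
    push_cast
    field_simp
    ring
  calc Real.exp (-2) = Real.exp (-(2 / N)) ^ N := by
        rw [← Real.exp_nat_mul]; congr 1; field_simp
    _ ≤ _ := by
        rw [Nat.add_sub_cancel]
        exact pow_le_pow_left₀ (Real.exp_pos _).le h1 _

theorem exp_neg_two_bounds : 1 / 10 ≤ Real.exp (-2) ∧ Real.exp (-2) ≤ 1 / 7 := by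
  have h : Real.exp (-2) = (Real.exp 1 ^ 2)⁻¹ := by
    rw [Real.exp_neg, ← Real.exp_nat_mul]; norm_num
  have h1 := Real.exp_one_gt_d9
  have h2 := Real.exp_one_lt_d9
  rw [h]
  constructor
  · rw [one_div]; exact inv_anti₀ (by positivity) (by nlinarith)
  · rw [one_div]; exact inv_anti₀ (by norm_num) (by nlinarith)

theorem base_pow_ge {n : ℕ} (hn : 3 ≤ n) :
    Real.exp (-2) / 2 + 1 / 100 ≤ (((n : ℝ) - 2) / n) ^ (n - 1) := by
  obtain ⟨h1, h2⟩ := exp_neg_two_bounds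
  -- From `n = 5` on, the factor beyond the power `n - 2` is at least `3/5`, and `exp (-2) / 10 ≥
  -- 1/100` covers the slack.
  obtain rfl | rfl | h5 : n = 3 ∨ n = 4 ∨ 5 ≤ n := by omega
  · norm_num; linarith
  · norm_num; linarith
  · have h3 := exp_neg_two_le_base_pow hn
    have h4 : 3 / 5 ≤ ((n : ℝ) - 2) / n := by
      have : (5 : ℝ) ≤ n := by exact_mod_cast h5
      rw [div_le_div_iff₀ (by norm_num) (by linarith)]; linarith
    rw [show n - 1 = n - 2 + 1 by omega, pow_succ]
    have := mul_le_mul h3 h4 (by norm_num) (by positivity [base_pos hn])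
    linarith

/-! ### Integers that fit a frequency -/

theorem Fits.abs_sub_lt {n : ℕ} {σ : ℝ} {v : ℤ} (h : Fits n σ v) :
    |σ - pValue n v| < Real.exp (-2) / 2 / n := by
  have he : Real.exp (-2) = (Real.exp 1 ^ 2)⁻¹ := by
    rw [Real.exp_neg, ← Real.exp_nat_mul]; norm_num
  refine h.trans_eq ?_
  rw [he]
  simp only [div_eq_mul_inv, mul_inv]
  ring

/-- A smaller `v` would lie below `p_h` by at least the tolerance plus the allowed deviation
`1/(100n)`. -/
theorem Fits.le_of_frequency_ge {n h : ℕ} (hn : 3 ≤ n) (hh : h ≤ n) {σ : ℝ} {v : ℤ}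
    (hv : Fits n σ v) (hσ : pValue n h - 1 / (100 * n) ≤ σ) : (h : ℤ) ≤ v := by
  by_contra! hlt
  have h1 := pValue_gap hn (M := n - 1) hlt (by omega)
  have h2 := abs_lt.mp hv.abs_sub_lt
  have h3 := div_le_div_of_nonneg_right (base_pow_ge hn) (show (0 : ℝ) ≤ n by positivity)
  rw [add_div, div_div (1 : ℝ)] at h3
  linarith

/-- Below `n` the values `p_v` are at least `exp (-2) / n` apart, which is twice the strict
tolerance. At `n` the gap can be too small, so uniqueness may fail there. -/
theorem Fits.lt_of_lt {n : ℕ} (hn : 3 ≤ n) {σ : ℝ} {v w : ℤ} (hv : Fits n σ v)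
    (hw : Fits n σ w) (hvw : v < w) : (n : ℤ) ≤ w := by
  by_contra! hlt
  have h1 := pValue_gap hn (M := n - 2) hvw (by omega)
  have h2 := abs_lt.mp hv.abs_sub_lt
  have h4 := abs_lt.mp hw.abs_sub_lt
  have h3 := div_le_div_of_nonneg_right (exp_neg_two_le_base_pow hn)
    (show (0 : ℝ) ≤ n by positivity)
  have h5 : Real.exp (-2) / n = Real.exp (-2) / 2 / n + Real.exp (-2) / 2 / n := by ring
  linarith

theorem Fits.not_pos_of_zero {n : ℕ} (hn : 3 ≤ n) {σ : ℝ} {w : ℤ} (hv : Fits n σ 0)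
    (hw : Fits n σ w) : w ≤ 0 := by
  by_contra! hlt
  have h0 := pValue_gap hn (M := 0) (show (0 : ℤ) < 1 by norm_num) (by norm_num)
  have h1 : pValue n 1 ≤ pValue n w := by
    rw [pValue_eq hn, pValue_eq hn]
    have := zpow_le_zpow_right_of_le_one₀ (base_pos hn) (base_le_one hn) (show 1 ≤ w by omega)
    linarith
  have h2 := abs_lt.mp hv.abs_sub_lt
  have h4 := abs_lt.mp hw.abs_sub_lt
  have h3 := div_le_div_of_nonneg_right (show Real.exp (-2) ≤ 1 by simp)
    (show (0 : ℝ) ≤ n by positivity)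
  have h5 : Real.exp (-2) / n = Real.exp (-2) / 2 / n + Real.exp (-2) / 2 / n := by ring
  rw [pow_zero] at h0
  linarith

/-- Nonnegative tallies with sum `n` are determined by the frequencies. -/
theorem eq_of_fits {n m : ℕ} (hn : 3 ≤ n) {σ : Fin m → ℝ} {y z : Fin m → ℤ}
    (hy : ∀ k, Fits n (σ k) (y k)) (hz : ∀ k, Fits n (σ k) (z k))
    (hy0 : ∀ k, 0 ≤ y k)
    (hys : ∑ k, y k = n) (hzs : ∑ k, z k = n) : y = z := by
  by_contra hne
  obtain ⟨k, hk⟩ : ∃ k, y k < z k := by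
    by_contra! h
    exact hne (funext fun k => ((Finset.sum_eq_sum_iff_of_le fun k _ => h k).mp
      (hzs.trans hys.symm) k (Finset.mem_univ k)).symm)
  obtain ⟨l, hl⟩ : ∃ l, z l < y l := by
    by_contra! h
    exact hne (funext fun k => (Finset.sum_eq_sum_iff_of_le fun k _ => h k).mp
      (hys.trans hzs.symm) k (Finset.mem_univ k))
  have hkl : l ≠ k := by rintro rfl; omega
  have h1 := (hy k).lt_of_lt hn (hz k) hk
  -- The ambiguous tally `y l` alone uses up the total `n`, so `y k = 0`; but 0 and the positive `z
  -- k` cannot both fit.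
  have h2 := (hz l).lt_of_lt hn (hy l) hl
  have h3 : y k + y l ≤ n := by
    rw [← hys, ← Finset.sum_pair hkl.symm]
    exact Finset.sum_le_sum_of_subset_of_nonneg (Finset.subset_univ _) fun i _ _ => hy0 i
  have h4 : y k = 0 := by have := hy0 k; omega
  have h5 := (h4 ▸ hy k).not_pos_of_zero hn (hz k)
  omega

/-! ### Inputs for the corrupt participants -/

theorem exists_fiber_card_eq {α β : Type} [Fintype α] [Fintype β] [DecidableEq β] (d : β → ℕ)
    (hd : ∑ k, d k = Fintype.card α) :
    ∃ w : α → β, ∀ k, (Finset.univ.filter fun a => w a = k).card = d k := by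
  have e : α ≃ Σ k, Fin (d k) := Fintype.equivOfCardEq (by simp [hd])
  refine ⟨fun a => (e a).1, fun k => ?_⟩
  rw [Finset.card_filter, Fintype.sum_equiv e _ (fun p => if p.1 = k then 1 else 0) fun _ => rfl,
    Fintype.sum_sigma, Fintype.sum_eq_single k]
  · simp
  · intro l hl
    simp [hl]

theorem idealTally_allInputs {n m : ℕ} {H : Finset (Fin n)} (x : H → Fin m)
    (w : {l : Fin n // l ∉ H} → Fin m) (k : Fin m) :
    idealTally (allInputs x w) k = (Finset.univ.filter fun i => x i = k).card +
      (Finset.univ.filter fun i => w i = k).card := by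
  classical
  simp only [idealTally, Finset.card_filter]
  push_cast
  rw [← Fintype.sum_subtype_add_sum_subtype (fun i => i ∈ H)]
  congr 1
  · refine Finset.sum_congr (by ext; simp) fun i _ => ?_
    simp [allInputs, i.2]
  · refine Finset.sum_congr rfl fun i _ => ?_
    simp [allInputs, i.2]

theorem output_eq_some {n m s : ℕ} {rule : ℝ → Option ℤ} (hr : IsTallyRule n rule)
    {b : Broadcast n m s} {y : Fin m → ℤ} (h : output rule b = some y) :
    (∀ i k j, (b i k j).isSome) ∧ (∀ k, Fits n (frequency b k) (y k)) ∧ ∑ k, y k = n := by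
  unfold output at h
  split_ifs at h with hc
  obtain rfl := Option.some.inj h
  refine ⟨hc.1, fun k => hr.fits _ _ ?_, hc.2.2⟩
  obtain ⟨v, hv⟩ := Option.isSome_iff_exists.mp (hc.2.1 k)
  simp [hv]

/-- The number of votes of honest participants for a candidate. -/
def honestTally {n m : ℕ} {H : Finset (Fin n)} (x : H → Fin m) (k : Fin m) : ℕ :=
  (Finset.univ.filter fun i => x i = k).card

theorem correct_of_frequency_ge {n m s : ℕ} (hn : 3 ≤ n) (hm : 1 ≤ m) {H : Finset (Fin n)}
    {x : H → Fin m} {rule : H → ℝ → Option ℤ} (hr : ∀ i, IsTallyRule n (rule i))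
    {b : Broadcast n m s}
    (hb : ∀ k, (∀ i k j, (b i k j).isSome) →
      pValue n (honestTally x k) - 1 / (100 * n) ≤ frequency b k) :
    Correct x rule b := by
  by_cases hout : ∃ i y, output (rule i) b = some y
  · obtain ⟨i, y, hy⟩ := hout
    obtain ⟨hc, hfit, hsum⟩ := output_eq_some (hr i) hy
    have hle : ∀ k, honestTally x k ≤ n := fun k =>
      (Finset.card_le_univ _).trans (by simpa using Finset.card_le_univ H)
    have hge : ∀ {z : Fin m → ℤ}, (∀ k, Fits n (frequency b k) (z k)) →
        ∀ k, (honestTally x k : ℤ) ≤ z k :=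
      fun hz k => (hz k).le_of_frequency_ge hn (hle k) (hb k hc)
    have hH : ∑ k, honestTally x k = H.card := by
      simpa [honestTally] using (Finset.card_eq_sum_card_fiberwise
        (s := Finset.univ) (t := Finset.univ) (f := x) (by simp [Set.MapsTo])).symm
    -- The surpluses over the honest tallies are nonnegative and sum to `n - H.card`, the number of
    -- corrupt participants.
    obtain ⟨w, hw⟩ := exists_fiber_card_eq (α := {l : Fin n // l ∉ H})
      (fun k => (y k - honestTally x k).toNat) (by
        zify
        rw [Finset.sum_congr rfl fun k _ =>
          Int.toNat_of_nonneg (sub_nonneg.mpr (hge hfit k)), Finset.sum_sub_distrib, hsum,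
          ← Nat.cast_sum, hH, Fintype.card_subtype_compl, Fintype.card_coe, Fintype.card_fin,
          Nat.cast_sub (by simpa using Finset.card_le_univ H)])
    refine ⟨w, fun i' z hz => ?_⟩
    obtain ⟨-, hfit', hsum'⟩ := output_eq_some (hr i') hz
    have hzy : z = y := eq_of_fits hn hfit' hfit
      (fun k => (Int.natCast_nonneg _).trans (hge hfit' k)) hsum' hsum
    funext k
    rw [hzy, idealTally_allInputs, hw, Int.toNat_of_nonneg (sub_nonneg.mpr (hge hfit k)),
      honestTally]
    ring
  -- If everyone aborts, any inputs serve; `hm` supplies a candidate.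
  · exact ⟨fun _ => ⟨0, hm⟩, fun i y hy => (hout ⟨i, y, hy⟩).elim⟩

theorem sumLaw_toReal {n m : ℕ} (hn : 3 ≤ n) {H : Finset (Fin n)} (x : H → Fin m) (k : Fin m) :
    (sumLaw x k 1).toReal = pValue n (honestTally x k) ∧
      (sumLaw x k 0).toReal = 1 - pValue n (honestTally x k) := by
  have h1 := toReal_zero_add_toReal_one (sumLaw x k)
  have h2 := sumLaw_sign hn x k
  have e0 : sign 0 = 1 := if_pos rfl
  have e1 : sign 1 = -1 := if_neg (by decide)
  rw [sum_bit, e0, e1] at h2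
  rw [pValue_eq hn, zpow_natCast, honestTally]
  constructor <;> linarith

/-! ### The exponential bound -/

/-- `(1 - t + t²/2)(1 + t + t²/2) = 1 + t⁴/4 ≥ 1`, and the second factor is at most `exp t`. -/
theorem exp_neg_le_quadratic {t : ℝ} (ht : 0 ≤ t) : Real.exp (-t) ≤ 1 - t + t ^ 2 / 2 := by
  have h := Real.quadratic_le_exp_of_nonneg ht
  rw [Real.exp_neg]
  refine (inv_anti₀ (by positivity) h).trans ?_
  rw [inv_le_iff_one_le_mul₀ (by positivity)]
  nlinarith [pow_nonneg ht 4]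

/-- Adding a fixed bit to a bit that is `1` with probability `p ≤ 1 / 2` makes `1` at least
as likely. -/
theorem bernoulli_exp_le {p t : ℝ} (hp : 0 ≤ p) (hp2 : p ≤ 1 / 2) (ht : 0 ≤ t) (ht1 : t ≤ 1)
    (c : Bit) :
    (1 - p) * Real.exp (-(t * if 0 + c = 1 then 1 else 0)) +
      p * Real.exp (-(t * if 1 + c = 1 then 1 else 0)) ≤ Real.exp (t ^ 2 / 2 - t * p) := by
  have h1 := exp_neg_le_quadratic ht
  have h2 := Real.add_one_le_exp (t ^ 2 / 2 - t * p)
  have h3 : 0 ≤ t - t ^ 2 / 2 := by nlinarith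
  obtain rfl | rfl : c = 0 ∨ c = 1 := by revert c; decide
  · rw [if_neg (by decide), if_pos (by decide)]
    simp only [mul_zero, neg_zero, Real.exp_zero, mul_one]
    nlinarith [mul_le_mul_of_nonneg_left h1 hp]
  · rw [if_pos (by decide), if_neg (by decide)]
    simp only [mul_zero, neg_zero, Real.exp_zero, mul_one]
    nlinarith [mul_le_mul_of_nonneg_left h1 (show 0 ≤ 1 - p by linarith)]

/-- A Chernoff bound with the deviation `t` itself as exponential parameter: the exponent is `s
(t²/2 - tp) + st (p - t) = -st²/2`. The shifts `C j` may vary with `j`. -/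
theorem independent_sumLaw_le {n m s : ℕ} (hn : 3 ≤ n) {H : Finset (Fin n)} (x : H → Fin m)
    (k : Fin m) (C : Fin s → Bit) {t : ℝ} (ht : 0 ≤ t) (ht1 : t ≤ 1) :
    (independent fun _ : Fin s => sumLaw x k).toOuterMeasure
      {f | (∑ j, if f j + C j = 1 then (1 : ℝ) else 0) ≤
        s * (pValue n (honestTally x k) - t)} ≤ ENNReal.ofReal (Real.exp (-(s * t ^ 2 / 2))) := by
  obtain ⟨h1, h0⟩ := sumLaw_toReal hn x k
  set p := pValue n (honestTally x k)
  have e1 : sumLaw x k 1 = ENNReal.ofReal p := by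
    rw [← h1, ENNReal.ofReal_toReal (PMF.apply_ne_top _ _)]
  have e0 : sumLaw x k 0 = ENNReal.ofReal (1 - p) := by
    rw [← h0, ENNReal.ofReal_toReal (PMF.apply_ne_top _ _)]
  have hp0 : 0 ≤ p := pValue_nonneg hn _
  have hp2 : p ≤ 1 / 2 := pValue_le_half hn _
  refine (independent_toOuterMeasure_le _
    (fun j b => ENNReal.ofReal (Real.exp (-(t * if b + C j = 1 then 1 else 0))))
    (ENNReal.ofReal (Real.exp (t * (s * (p - t)))))
    (ENNReal.ofReal (Real.exp (t ^ 2 / 2 - t * p))) _ ?_ ?_).trans_eq ?_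
  · intro f hf
    rw [← ENNReal.ofReal_prod_of_nonneg fun _ _ => (Real.exp_pos _).le,
      ← ENNReal.ofReal_mul (Real.exp_pos _).le, ← Real.exp_sum, ← Real.exp_add,
      ENNReal.one_le_ofReal, Real.one_le_exp_iff, Finset.sum_neg_distrib, ← Finset.mul_sum,
      ← sub_eq_add_neg, ← mul_sub]
    exact mul_nonneg ht (sub_nonneg.mpr hf)
  · intro j
    rw [sum_bit, e0, e1, ← ENNReal.ofReal_mul (by linarith), ← ENNReal.ofReal_mul hp0,
      ← ENNReal.ofReal_add (mul_nonneg (by linarith) (Real.exp_pos _).le) (by positivity)]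
    exact ENNReal.ofReal_le_ofReal (bernoulli_exp_le hp0 hp2 ht ht1 (C j))
  · rw [← ENNReal.ofReal_pow (Real.exp_pos _).le, ← ENNReal.ofReal_mul (Real.exp_pos _).le,
      ← Real.exp_nat_mul, ← Real.exp_add, Fintype.card_fin]
    congr 2
    ring

/-- If the broadcast is complete, then the frequency for a candidate is hardly ever much smaller
than it would be without votes of corrupt participants. -/
theorem voteLaw_frequency_lt_le {n m s : ℕ} (hn : 3 ≤ n) {H : Finset (Fin n)} (x : H → Fin m)
    (adv : Adversary H m s) (k : Fin m) {t : ℝ} (ht : 0 ≤ t) (ht1 : t ≤ 1) :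
    (voteLaw x adv).toOuterMeasure {b | (∀ i k j, (b i k j).isSome) ∧
      frequency b k < pValue n (honestTally x k) - t} ≤
        ENNReal.ofReal (Real.exp (-(s * t ^ 2 / 2))) := by
  rw [voteLaw_eq]
  refine toOuterMeasure_bind_le fun U => toOuterMeasure_bind_le fun a => ?_
  let C : Fin s → Bit := fun j => ∑ i, if h : i ∈ H then
    ∑ l, (received U a ⟨i, h⟩ k j l).getD 0 else (a.announced ⟨i, h⟩ k j).getD 0
  refine le_trans ?_ (independent_sumLaw_le hn x k C ht ht1)
  rw [← bitsLaw_map_sum, PMF.toOuterMeasure_map_apply, PMF.toOuterMeasure_map_apply]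
  refine MeasureTheory.measure_mono ?_
  rintro P ⟨hc, hf⟩
  simp only [frequency, parity?_broadcast P U a hc, Option.some.injEq] at hf
  change (∑ j, if ∑ i, P i k j + C j = 1 then (1 : ℝ) else 0) ≤ _
  -- The frequency divides by `s`; for `s = 0` the required inequality is `0 ≤ 0`.
  rcases Nat.eq_zero_or_pos s with rfl | hs
  · simp
  · rw [div_lt_iff₀' (by exact_mod_cast hs)] at hf
    exact hf.le

end Vote

/-! ### The union bound over candidates -/

theorem mainTheorem1 :
    ∃ c : ℝ, 0 < c ∧
      ∀ (n m s : ℕ), 3 ≤ n → 1 ≤ m →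
      ∀ (H : Finset (Fin n)) (x : H → Fin m) (adv : Vote.Adversary H m s)
        (rule : H → ℝ → Option ℤ), (∀ i, Vote.IsTallyRule n (rule i)) →
        (Vote.voteLaw x adv).toOuterMeasure {b | ¬ Vote.Correct x rule b} ≤
          ENNReal.ofReal (m * Real.exp (-(c * s / (n : ℝ) ^ 2))) := by
  -- The deviation is `t = 1/(100n)`, so `t²/2 = 1/(20000 n²)`.
  refine ⟨1 / 20000, by norm_num, fun n m s hn hm H x adv rule hr => ?_⟩
  have hn' : (3 : ℝ) ≤ n := by exact_mod_cast hn
  have ht1 : 1 / (100 * (n : ℝ)) ≤ 1 := by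
    rw [div_le_one (by positivity)]; linarith
  calc (Vote.voteLaw x adv).toOuterMeasure {b | ¬ Vote.Correct x rule b}
      ≤ (Vote.voteLaw x adv).toOuterMeasure (⋃ k, {b | (∀ i k j, (b i k j).isSome) ∧
          Vote.frequency b k < Vote.pValue n (Vote.honestTally x k) - 1 / (100 * n)}) := by
        refine MeasureTheory.measure_mono fun b hb => ?_
        by_contra hcon
        simp only [Set.mem_iUnion, Set.mem_ofPred_eq, not_exists, not_and, not_lt] at hcon
        exact hb (Vote.correct_of_frequency_ge hn hm hr hcon)
    _ ≤ ∑ _k : Fin m, ENNReal.ofReal (Real.exp (-(s * (1 / (100 * n)) ^ 2 / 2))) :=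
        (MeasureTheory.measure_iUnion_fintype_le _ _).trans <| Finset.sum_le_sum fun k _ =>
          Vote.voteLaw_frequency_lt_le hn x adv k (by positivity) ht1
    _ = ENNReal.ofReal (m * Real.exp (-(1 / 20000 * s / (n : ℝ) ^ 2))) := by
        rw [Finset.sum_const, Finset.card_univ, Fintype.card_fin, nsmul_eq_mul,
          ENNReal.ofReal_mul (by positivity), ENNReal.ofReal_natCast]
        congr 4
        ring
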